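/- Let $n\ge 0$, let $X$ be a compact metrizable space, and let $T\colon\mathbb R^n\times X\to X$ be a continuous action. For $x\in X$ let $\mathfrak g_x$ be the largest linear subspace of $\mathbb R^n$ such that $T^t x=x$ for all $t\in\mathfrak g_x$. For $k\ge 0$ put $X_k=\{x\in X:\dim\mathfrak g_x\ge k\}$ (so $X_0=X$, $X_n$ is the set of fixed points, and $X_{n+1}=\emptyset$), and $$\tilde X_k=\{(x,y)\in (X_k\setminus X_{k+1})^2 : x\ne y,\ \mathfrak g_x=\mathfrak g_y\}.$$ Let $Y=\mathrm{Lip}_1(\mathbb R^n,[0,1])$ be the space of maps $\varphi\colon\mathbb R^n\to[0,1]$ with $|\varphi(t)-\varphi(u)|\le|t-u|$ for all $t,u$ (Euclidean norm), with the metric $$\mathbf d(\varphi,\psi)=\sup_{m\ge1}\Bigl(2^{-m}\sup_{|t|\le m}|\varphi(t)-\psi(t)|\Bigr),$$ which induces the compact-open topology, and with the shift action $(\sigma^u\varphi)(t)=\varphi(t+u)$ of $\mathbb R^n$. Let $Y_n\subset Y$ be the set of the $\varphi$ that are invariant under translation by all elements of some linear subspace of $\mathbb R^n$ of dimension at least $n$,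 i.e. the set of constant functions. Let $\iota\colon X_n\to Y_n$ be a topological embedding, and let $\mathcal C$ be the space of continuous maps $f\colon X\to Y$ with $f\circ T^t=\sigma^t\circ f$ for all $t\in\mathbb R^n$ and $f(x)=\iota(x)$ for all $x\in X_n$, with the metric $D(f,g)=\sup_{x\in X}\mathbf d(f(x),g(x))$. Then for every integer $k$ with $0\le k\le n-1$ and every $(p,q)\in\tilde X_k$ there exist closed neighbourhoods $B$ of $p$ in $X_k$ and $B'$ of $q$ in $X_k$ (closed sets and neighbourhoods in the subspace topology of $X_k$) such that $$B\cap X_{k+1}=B'\cap X_{k+1}=B\cap B'=\emptyset$$ and such that the set $$\mathcal C_k(B,B')=\{f\in\mathcal C : f(x)\ne f(y)\text{ for all }(x,y)\in(B\times B')\cap\tilde X_k\}$$ is open and dense in $\mathcal C$. -/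

import Mathlib

open scoped Topology

namespace LipFlow

/-- The group `ℝⁿ` with its Euclidean norm. -/
abbrev E (n : ℕ) : Type := EuclideanSpace ℝ (Fin n)

/-- `Lip₁(ℝⁿ, I)`: the one-Lipschitz maps from `ℝⁿ` to the unit interval. -/
def LipOne (n : ℕ) : Type := {φ : E n → unitInterval // LipschitzWith 1 φ}

namespace LipOne

variable {n : ℕ}

instance : CoeFun (LipOne n) (fun _ => E n → unitInterval) := ⟨fun φ => φ.1⟩

theorem ext' {φ ψ : LipOne n} (h : ∀ t, φ t = ψ t) : φ = ψ := Subtype.ext (funext h)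

/-- The shift action `(u, φ) ↦ φ(· + u)` of `ℝⁿ` on `Lip₁(ℝⁿ, I)`. -/
instance : AddAction (E n) (LipOne n) where
  vadd u φ := ⟨fun t => φ (t + u), fun s t => by simpa using φ.2 (s + u) (t + u)⟩
  zero_vadd φ := ext' fun t => congrArg φ.1 (add_zero t)
  add_vadd u v φ := ext' fun t => congrArg φ.1 (by rw [← add_assoc])

theorem vadd_apply (u : E n) (φ : LipOne n) (t : E n) : (u +ᵥ φ) t = φ (t + u) := rfl

/-- `sup_{|t| ≤ m} |φ(t) - ψ(t)|`. -/
noncomputable def supBall (φ ψ : LipOne n) (m : ℕ) : ℝ :=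
  ⨆ t : Metric.closedBall (0 : E n) m, dist (φ t) (ψ t)

/-- The metric `𝐝(φ, ψ) = sup_{m ≥ 1} 2^{-m} sup_{|t| ≤ m} |φ(t) - ψ(t)|`. -/
noncomputable def d (φ ψ : LipOne n) : ℝ :=
  ⨆ m : ℕ+, ((2 : ℝ)⁻¹) ^ (m : ℕ) * supBall φ ψ m

theorem dist_le_one (a b : unitInterval) : dist a b ≤ 1 := by
  rw [Subtype.dist_eq, Real.dist_eq, abs_le]
  constructor <;> linarith [a.2.1, a.2.2, b.2.1, b.2.2]

instance (m : ℕ) : Nonempty (Metric.closedBall (0 : E n) m) :=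
  ⟨⟨0, Metric.mem_closedBall_self (Nat.cast_nonneg m)⟩⟩

theorem le_supBall (φ ψ : LipOne n) (m : ℕ) {t : E n} (ht : ‖t‖ ≤ m) :
    dist (φ t) (ψ t) ≤ supBall φ ψ m :=
  le_ciSup (f := fun t : Metric.closedBall (0 : E n) m => dist (φ t) (ψ t))
    ⟨1, by rintro _ ⟨t, rfl⟩; exact dist_le_one _ _⟩ ⟨t, by simpa using ht⟩

theorem supBall_le (φ ψ : LipOne n) (m : ℕ) {c : ℝ}
    (h : ∀ t : E n, ‖t‖ ≤ m → dist (φ t) (ψ t) ≤ c) : supBall φ ψ m ≤ c :=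
  ciSup_le fun t => h t (mem_closedBall_zero_iff.1 t.2)

theorem supBall_nonneg (φ ψ : LipOne n) (m : ℕ) : 0 ≤ supBall φ ψ m :=
  Real.iSup_nonneg fun _ => dist_nonneg

theorem le_d (φ ψ : LipOne n) (m : ℕ+) : ((2 : ℝ)⁻¹) ^ (m : ℕ) * supBall φ ψ m ≤ d φ ψ :=
  le_ciSup (f := fun m : ℕ+ => ((2 : ℝ)⁻¹) ^ (m : ℕ) * supBall φ ψ m)
    ⟨1, by
      rintro _ ⟨m, rfl⟩
      exact mul_le_one₀ (pow_le_one₀ (by norm_num) (by norm_num)) (supBall_nonneg _ _ _)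
        (supBall_le _ _ _ fun t _ => dist_le_one _ _)⟩ m

theorem dist_apply_le (φ ψ : LipOne n) (m : ℕ+) {t : E n} (ht : ‖t‖ ≤ (m : ℕ)) :
    dist (φ t) (ψ t) ≤ 2 ^ (m : ℕ) * d φ ψ := by
  have h1 := le_d φ ψ m
  have h2 := le_supBall φ ψ m ht
  rw [inv_pow, inv_mul_le_iff₀ (by positivity)] at h1
  exact h2.trans h1

theorem exists_norm_le (t : E n) : ∃ m : ℕ+, ‖t‖ ≤ (m : ℕ) := by
  obtain ⟨m, hm⟩ := exists_nat_ge ‖t‖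
  exact ⟨⟨m + 1, m.succ_pos⟩, hm.trans (by simp)⟩

/-- `Lip₁(ℝⁿ, I)` with the metric `𝐝`. -/
noncomputable instance : MetricSpace (LipOne n) where
  dist := d
  dist_self φ := by simp [d, supBall]
  dist_comm φ ψ := by simp only [d, supBall, dist_comm]
  dist_triangle φ ψ χ := ciSup_le fun m => by
    have h : supBall φ χ m ≤ supBall φ ψ m + supBall ψ χ m :=
      supBall_le _ _ _ fun t ht => (dist_triangle _ (ψ t) _).trans
        (add_le_add (le_supBall _ _ _ ht) (le_supBall _ _ _ ht))
    calc _ ≤ ((2 : ℝ)⁻¹) ^ (m : ℕ) * (supBall φ ψ m + supBall ψ χ m) := by gcongr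
      _ ≤ d φ ψ + d ψ χ := by
        rw [mul_add]; exact add_le_add (le_d _ _ _) (le_d _ _ _)
  eq_of_dist_eq_zero {φ ψ} h := ext' fun t => by
    obtain ⟨m, hm⟩ := exists_norm_le t
    have := dist_apply_le φ ψ m hm
    rw [show d φ ψ = 0 from h, mul_zero] at this
    exact dist_le_zero.1 this

theorem dist_eq_d (φ ψ : LipOne n) : dist φ ψ = d φ ψ := rfl

/-- A one-Lipschitz map as a continuous map. -/
def toCM (φ : LipOne n) : C(E n, unitInterval) := ⟨φ.1, φ.2.continuous⟩

/-- The metric `𝐝` induces the compact-open topology. -/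
theorem isEmbedding_toCM : Topology.IsEmbedding (toCM : LipOne n → C(E n, unitInterval)) := by
  refine ⟨Topology.isInducing_iff_nhds.2 fun φ => le_antisymm ?_ ?_, ?_⟩
  · rw [← Filter.tendsto_iff_comap,
      ContinuousMap.tendsto_iff_forall_isCompact_tendstoUniformlyOn]
    intro K hK
    obtain ⟨R, hR⟩ := hK.isBounded.exists_norm_le
    obtain ⟨N, hN⟩ := exists_nat_ge R
    rw [Metric.tendstoUniformlyOn_iff]
    intro ε hε
    have hpos : (0 : ℝ) < ε / 2 ^ (N + 1) := by positivity
    filter_upwards [Metric.ball_mem_nhds φ hpos] with ψ hψ t ht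
    have h1 := dist_apply_le φ ψ ⟨N + 1, N.succ_pos⟩ (t := t)
      (((hR t ht).trans hN).trans (by simp))
    rw [Metric.mem_ball, dist_comm, dist_eq_d, lt_div_iff₀ (by positivity), mul_comm] at hψ
    exact h1.trans_lt hψ
  · have key := (ContinuousMap.tendsto_iff_forall_isCompact_tendstoUniformlyOn
      (F := fun ψ : LipOne n => toCM ψ) (p := Filter.comap toCM (𝓝 (toCM φ)))
      (f := toCM φ)).1 Filter.tendsto_comap
    rw [← Filter.tendsto_id', Metric.tendsto_nhds]
    intro ε hε
    obtain ⟨N, hN⟩ := exists_pow_lt_of_lt_one (half_pos hε) (show (2 : ℝ)⁻¹ < 1 by norm_num)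
    have h1 := key _ (isCompact_closedBall (0 : E n) N)
    rw [Metric.tendstoUniformlyOn_iff] at h1
    filter_upwards [h1 (ε / 2) (half_pos hε)] with ψ hψ
    refine lt_of_le_of_lt (b := ε / 2) ?_ (half_lt_self hε)
    rw [dist_comm]
    refine ciSup_le fun m => ?_
    rcases le_total (m : ℕ) N with hm | hm
    · have h2 : supBall φ ψ m ≤ ε / 2 := supBall_le _ _ _ fun t ht =>
        (hψ t (by simpa using ht.trans (Nat.cast_le.2 hm))).le
      exact (mul_le_of_le_one_left (supBall_nonneg _ _ _)
        (pow_le_one₀ (by norm_num) (by norm_num))).trans h2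
    · have h2 : supBall φ ψ m ≤ 1 := supBall_le _ _ _ fun t _ => dist_le_one _ _
      exact (mul_le_of_le_one_right (by positivity) h2).trans
        ((pow_le_pow_of_le_one (by norm_num) (by norm_num) hm).trans hN.le)
  · intro φ ψ h
    exact ext' fun t => congrArg (fun f : C(E n, unitInterval) => f t) h

/-- `Y_k`: the `φ ∈ Lip₁(ℝⁿ, I)` invariant under translation by the elements of some linear
subspace of dimension at least `k`. -/
def level (n k : ℕ) : Set (LipOne n) :=
  {φ | ∃ V : Submodule ℝ (E n), k ≤ Module.finrank ℝ V ∧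
    ∀ t : E n, ∀ u ∈ V, φ (t + u) = φ t}

end LipOne

/-- `𝔤_x`: the largest linear subspace of `ℝⁿ` acting trivially on `x`. It consists of the `t`
whose whole line `ℝ t` fixes `x`; see `isGreatest_isotropy`. -/
def isotropy (n : ℕ) {X : Type*} [AddAction (E n) X] (x : X) : Submodule ℝ (E n) where
  carrier := {t | ∀ a : ℝ, (a • t) +ᵥ x = x}
  zero_mem' a := by simp
  add_mem' {s t} hs ht a := by rw [smul_add, add_vadd, ht, hs]
  smul_mem' c t ht a := by rw [smul_smul]; exact ht _

theorem isGreatest_isotropy (n : ℕ) {X : Type*} [AddAction (E n) X] (x : X) :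
    IsGreatest {V : Submodule ℝ (E n) | ∀ t ∈ V, t +ᵥ x = x} (isotropy n x) :=
  ⟨fun t ht => by simpa using ht 1, fun V hV t ht a => hV _ (V.smul_mem a ht)⟩

/-- `X_k = {x ∈ X | dim 𝔤_x ≥ k}`; in particular `X_{n+1} = ∅`. -/
def stratum (n : ℕ) (X : Type*) [AddAction (E n) X] (k : ℕ) : Set X :=
  {x | k ≤ Module.finrank ℝ (isotropy n x)}

/-- `X̃_k`: pairs of distinct points of `X_k ∖ X_{k+1}` with `𝔤_x = 𝔤_y`. -/
def pairs (n : ℕ) (X : Type*) [AddAction (E n) X] (k : ℕ) : Set (X × X) :=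
  {z | z.1 ∈ stratum n X k \ stratum n X (k + 1) ∧ z.2 ∈ stratum n X k \ stratum n X (k + 1) ∧
    z.1 ≠ z.2 ∧ isotropy n z.1 = isotropy n z.2}

/-- `𝒞`: equivariant continuous maps `X → Lip₁(ℝⁿ, I)` which agree with `ι` on `X_n`. For compact
`X` it carries the metric `D(f, g) = sup_x 𝐝(f(x), g(x))` (the one Mathlib puts on `C(X, Y)`). -/
def mapSpace {n : ℕ} {X : Type*} [TopologicalSpace X] [AddAction (E n) X]
    (ι : stratum n X n → LipOne.level n n) : Set C(X, LipOne n) :=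
  {f | (∀ (t : E n) (x : X), f (t +ᵥ x) = t +ᵥ f x) ∧
    ∀ x : stratum n X n, f x = (ι x : LipOne n)}

theorem mapSpace_dist {n : ℕ} {X : Type*} [TopologicalSpace X] [CompactSpace X] [Nonempty X]
    [AddAction (E n) X] (ι : stratum n X n → LipOne.level n n) (f g : mapSpace ι) :
    dist f g = ⨆ x : X, LipOne.d (f.1 x) (g.1 x) :=
  ContinuousMap.dist_eq_iSup

/-- `𝒞_k(B, B')`: the `f ∈ 𝒞` with `f(x) ≠ f(y)` for all `(x, y) ∈ (B × B') ∩ X̃_k`. -/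
def separating {n : ℕ} {X : Type*} [TopologicalSpace X] [AddAction (E n) X]
    (ι : stratum n X n → LipOne.level n n) (k : ℕ) (B B' : Set X) : Set (mapSpace ι) :=
  {f | ∀ z ∈ (B ×ˢ B') ∩ pairs n X k, f.1 z.1 ≠ f.1 z.2}

/-- `B` is a closed neighbourhood of `p` in the subspace `S`. -/
def IsClosedNhdIn {X : Type*} [TopologicalSpace X] (S B : Set X) (p : X) : Prop :=
  B ⊆ S ∧ IsClosed ((↑) ⁻¹' B : Set S) ∧ B ∈ 𝓝[S] p

end LipFlow

/-! An equivariant `f` is determined by the scalar function `F x = f x 0`, which has values in `[0,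
1]` and is 1-Lipschitz along orbits; conversely each continuous such function gives an equivariant
map (`exists_orbit_map`). So density is a question about perturbing `F` while keeping it on fixed
points.

Choose a small `v` that moves `p` and a bump `z` that drops along `v` near `p` and vanishes along
the `v`-segment from points near `q` (`exists_bump`). Lower the slope of `F`, push it below 1 where
`z > 0`, and average along `v`, so that its restriction to each `v`-line has Lipschitz derivative.
Then add a ripple of amplitude `A` and frequency `N` in the averaged bump, with `A * N` fixed. If
the orbit functions of `x` and `y` still agreed, a difference of two smoothed functions would equal
the ripple. On some interval of length `1/m` the ripple has height of order `1/m`, whereas the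
smooth difference allows only order `1/m²`; this fails for large `m` (`exists_perturbation`).

Openness follows from compactness of the relevant set of pairs, itself a consequence of compactness
of the set of orthonormal `k`-frames. -/

namespace LipFlow

/-! ### Isotropy spaces and closedness of the strata -/

section Isotropy

variable {n : ℕ} {X : Type*} [AddAction (E n) X]

theorem vadd_eq_of_mem_isotropy {x : X} {t : E n} (ht : t ∈ isotropy n x) : t +ᵥ x = x := by
  simpa using ht 1

theorem isotropy_eq_top {x : X} (hx : x ∈ stratum n X n) : isotropy n x = ⊤ :=
  Submodule.eq_top_of_finrank_eq
    (le_antisymm (Submodule.finrank_le _) (by simpa [stratum] using hx))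

theorem vadd_eq_of_mem_stratum_top {x : X} (hx : x ∈ stratum n X n) (t : E n) : t +ᵥ x = x :=
  vadd_eq_of_mem_isotropy (by rw [isotropy_eq_top hx]; trivial)

theorem mem_stratum_top_of_forall {x : X} (hx : ∀ t : E n, t +ᵥ x = x) : x ∈ stratum n X n := by
  have : isotropy n x = ⊤ := eq_top_iff.2 fun t _ a => hx _
  change n ≤ Module.finrank ℝ (isotropy n x)
  rw [this, finrank_top, finrank_euclideanSpace_fin]

theorem stratum_antitone {j k : ℕ} (h : j ≤ k) : stratum n X k ⊆ stratum n X j :=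
  fun _ hx => h.trans hx

/-- A point which is not fixed is moved by arbitrarily small vectors. -/
theorem exists_norm_lt_vadd_ne {x : X} (hx : x ∉ stratum n X n) {ε : ℝ} (hε : 0 < ε) :
    ∃ v : E n, ‖v‖ < ε ∧ v +ᵥ x ≠ x := by
  by_contra! h
  refine hx (mem_stratum_top_of_forall fun t => ?_)
  -- Any `t` is `m` times the short vector `t / m`, which fixes `x`.
  obtain ⟨m, hm⟩ := exists_nat_gt (‖t‖ / ε)
  have hm0 : (0 : ℝ) < m := lt_of_le_of_lt (by positivity) hm
  have h1 : ((m : ℝ)⁻¹ • t) +ᵥ x = x := by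
    apply h
    rw [norm_smul, norm_inv, Real.norm_natCast, inv_mul_lt_iff₀ hm0]
    exact (div_lt_iff₀ hε).1 hm
  have h2 : ∀ j : ℕ, (j • ((m : ℝ)⁻¹ • t)) +ᵥ x = x := by
    intro j
    induction j with
    | zero => simp
    | succ j ih => rw [succ_nsmul, add_vadd, h1, ih]
  have h3 := h2 m
  rwa [← Nat.cast_smul_eq_nsmul ℝ, smul_smul, mul_inv_cancel₀ hm0.ne', one_smul] at h3

/-- Expresses a dimension bound through a frame ranging over a compact set. -/
theorem le_finrank_iff_exists_orthonormal {V : Submodule ℝ (E n)} {k : ℕ} :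
    k ≤ Module.finrank ℝ V ↔ ∃ e : Fin k → E n, Orthonormal ℝ e ∧ ∀ j, e j ∈ V := by
  constructor
  · intro h
    let b := stdOrthonormalBasis ℝ V
    refine ⟨fun j => (b (Fin.castLE h j) : E n), ?_, fun j => (b _).2⟩
    exact (b.orthonormal.comp_linearIsometry V.subtypeₗᵢ).comp _ (Fin.castLE_injective h)
  · rintro ⟨e, he, hV⟩
    have : LinearIndependent ℝ (fun j => (⟨e j, hV j⟩ : V)) :=
      LinearIndependent.of_comp V.subtype he.linearIndependent
    simpa using this.fintype_card_le_finrank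

variable [TopologicalSpace X] [CompactSpace X] [T2Space X] [ContinuousVAdd (E n) X]

/-- Being an orthonormal frame whose lines fix both points is a closed condition, and frames lie in
a product of unit balls, so the set is the projection of a compact set. -/
theorem isClosed_le_finrank_isotropy_inf (k : ℕ) :
    IsClosed {z : X × X | k ≤ Module.finrank ℝ (isotropy n z.1 ⊓ isotropy n z.2 :
      Submodule ℝ (E n))} := by
  let K : Set ((X × X) × (Fin k → E n)) :=
    {w | (∀ i j, inner ℝ (w.2 i) (w.2 j) = if i = j then (1 : ℝ) else 0) ∧
      ∀ j, ∀ a : ℝ, (a • w.2 j) +ᵥ w.1.1 = w.1.1 ∧ (a • w.2 j) +ᵥ w.1.2 = w.1.2}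
  have hK : IsClosed K := by
    refine IsClosed.and ?_ ?_
    · simp only [Set.ofPred_forall]
      refine isClosed_iInter fun i => isClosed_iInter fun j => isClosed_eq ?_ continuous_const
      fun_prop
    · simp only [Set.ofPred_forall]
      refine isClosed_iInter fun j => isClosed_iInter fun a => ?_
      refine (isClosed_eq ?_ ?_).and (isClosed_eq ?_ ?_) <;> fun_prop
  have hc : IsCompact (((Set.univ : Set (X × X)) ×ˢ
      Set.univ.pi fun _ : Fin k => Metric.closedBall (0 : E n) 1) ∩ K) :=
    (isCompact_univ.prod (isCompact_univ_pi fun _ => isCompact_closedBall _ _)).inter_right hK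
  convert (hc.image continuous_fst).isClosed using 1
  ext z
  simp only [Set.mem_ofPred_eq, le_finrank_iff_exists_orthonormal, Set.mem_image]
  constructor
  · rintro ⟨e, he, hV⟩
    refine ⟨(z, e), ⟨⟨trivial, fun j _ => ?_⟩, orthonormal_iff_ite.1 he,
      fun j a => ⟨(hV j).1 a, (hV j).2 a⟩⟩, rfl⟩
    simp [he.1 j]
  · rintro ⟨⟨z, e⟩, ⟨-, he, hV⟩, rfl⟩
    exact ⟨e, orthonormal_iff_ite.2 he, fun j => ⟨fun a => (hV j a).1, fun a => (hV j a).2⟩⟩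

theorem isClosed_stratum (k : ℕ) : IsClosed (stratum n X k) := by
  have := (isClosed_le_finrank_isotropy_inf (n := n) (X := X) k).preimage
    (continuous_id.prodMk continuous_id)
  convert this using 1
  ext x
  change k ≤ _ ↔ k ≤ Module.finrank ℝ (isotropy n x ⊓ isotropy n x : Submodule ℝ (E n))
  rw [inf_idem]

/-- The pairs of a product of disjoint compact sets lying in a single level of the
stratification form a compact set. -/
theorem isCompact_prod_inter_pairs {k : ℕ} {B B' : Set X} (hB : IsClosed B) (hB' : IsClosed B')
    (hk : B ⊆ stratum n X k) (hk' : B' ⊆ stratum n X k) (h1 : B ∩ stratum n X (k + 1) = ∅)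
    (h1' : B' ∩ stratum n X (k + 1) = ∅) (hd : B ∩ B' = ∅) :
    IsCompact ((B ×ˢ B') ∩ pairs n X k) := by
  suffices h : (B ×ˢ B') ∩ pairs n X k = (B ×ˢ B') ∩ {z : X × X | k ≤ Module.finrank ℝ
      (isotropy n z.1 ⊓ isotropy n z.2 : Submodule ℝ (E n))} by
    rw [h]
    exact ((hB.prod hB').inter (isClosed_le_finrank_isotropy_inf k)).isCompact
  ext ⟨x, y⟩
  refine and_congr_right fun ⟨hx, hy⟩ => ?_
  have hx1 : x ∉ stratum n X (k + 1) := fun h => h1.subset ⟨hx, h⟩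
  have hy1 : y ∉ stratum n X (k + 1) := fun h => h1'.subset ⟨hy, h⟩
  refine ⟨fun ⟨_, _, _, h⟩ => ?_, fun h => ⟨⟨hk hx, hx1⟩, ⟨hk' hy, hy1⟩, ?_, ?_⟩⟩
  · change isotropy n x = isotropy n y at h
    change k ≤ Module.finrank ℝ (isotropy n x ⊓ isotropy n y : Submodule ℝ (E n))
    rw [h, inf_idem]
    exact hk' hy
  · rintro h'
    exact hd.subset ⟨hx, (show x = y from h') ▸ hy⟩
  -- Both isotropy spaces have dimension at most `k` and their intersection at least `k`, so all
  -- three coincide.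
  · have fx : Module.finrank ℝ (isotropy n x) ≤ k := Nat.lt_succ_iff.1 (not_le.1 hx1)
    have fy : Module.finrank ℝ (isotropy n y) ≤ k := Nat.lt_succ_iff.1 (not_le.1 hy1)
    exact (Submodule.eq_of_le_of_finrank_le inf_le_left (fx.trans h)).symm.trans
      (Submodule.eq_of_le_of_finrank_le inf_le_right (fy.trans h))

end Isotropy

/-! ### Openness -/

theorem isOpen_separating {n : ℕ} {X : Type*} [TopologicalSpace X] [LocallyCompactSpace X]
    [AddAction (E n) X] (ι : stratum n X n → LipOne.level n n) {k : ℕ} {B B' : Set X}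
    (h : IsCompact ((B ×ˢ B') ∩ pairs n X k)) : IsOpen (separating ι k B B') := by
  have hc : Continuous fun w : mapSpace ι × (X × X) => (w.1.1 w.2.1, w.1.1 w.2.2) := by fun_prop
  have hU : IsOpen {w : mapSpace ι × (X × X) | w.1.1 w.2.1 ≠ w.1.1 w.2.2} :=
    isOpen_ne_fun hc.fst hc.snd
  exact isOpen_iff_eventually.2 fun f hf => h.eventually_forall_of_forall_eventually
    fun z hz => hU.eventually_mem (hf z hz)

/-! ### Lipschitz functions along orbits and infimal convolution -/

section OrbitLip

variable {n : ℕ} {X : Type*} [AddAction (E n) X]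

/-- `F` is `L`-Lipschitz along the orbits of the action of `ℝⁿ`. -/
def OrbitLip (n : ℕ) {X : Type*} [AddAction (E n) X] (L : ℝ) (F : X → ℝ) : Prop :=
  ∀ (t : E n) (x : X), |F (t +ᵥ x) - F x| ≤ L * ‖t‖

theorem OrbitLip.of_le {L : ℝ} {F : X → ℝ}
    (h : ∀ (t : E n) (x : X), F (t +ᵥ x) ≤ F x + L * ‖t‖) : OrbitLip n L F := fun t x => by
  have h1 := h t x
  have h2 := h (-t) (t +ᵥ x)
  rw [neg_vadd_vadd, norm_neg] at h2
  exact abs_le.2 ⟨by linarith, by linarith⟩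

theorem OrbitLip.mono {L L' : ℝ} {F : X → ℝ} (h : OrbitLip n L F) (hL : L ≤ L') :
    OrbitLip n L' F :=
  fun t x => (h t x).trans (by gcongr)

theorem OrbitLip.add {L L' : ℝ} {F G : X → ℝ} (hF : OrbitLip n L F) (hG : OrbitLip n L' G) :
    OrbitLip n (L + L') (fun x => F x + G x) := fun t x => by
  rw [add_sub_add_comm, add_mul]
  exact (abs_add_le _ _).trans (add_le_add (hF t x) (hG t x))

/-- The infimal convolution of `F` with the cone `t ↦ L‖t‖` along orbits. -/
noncomputable def infConv (n : ℕ) {X : Type*} [AddAction (E n) X] (L : ℝ) (F : X → ℝ) (x : X) :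
    ℝ :=
  ⨅ t : E n, (F (t +ᵥ x) + L * ‖t‖)

variable {L : ℝ} {F : X → ℝ}

theorem le_infConv {x : X} {c : ℝ} (h : ∀ t : E n, c ≤ F (t +ᵥ x) + L * ‖t‖) :
    c ≤ infConv n L F x :=
  le_ciInf h

theorem infConv_le_add (hL : 0 ≤ L) (hF : ∀ x, 0 ≤ F x) (x : X) (t : E n) :
    infConv n L F x ≤ F (t +ᵥ x) + L * ‖t‖ :=
  ciInf_le (f := fun t : E n => F (t +ᵥ x) + L * ‖t‖)
    ⟨0, by rintro _ ⟨t, rfl⟩; have := hF (t +ᵥ x); positivity⟩ t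

theorem infConv_le (hL : 0 ≤ L) (hF : ∀ x, 0 ≤ F x) (x : X) : infConv n L F x ≤ F x := by
  simpa using infConv_le_add hL hF x (0 : E n)

theorem infConv_nonneg (hL : 0 ≤ L) (hF : ∀ x, 0 ≤ F x) (x : X) : 0 ≤ infConv n L F x :=
  le_infConv fun t => by have := hF (t +ᵥ x); positivity

/-- Needed to preserve the prescribed values `ι` on fixed points. -/
theorem infConv_of_fixed (hL : 0 ≤ L) (hF : ∀ x, 0 ≤ F x) {x : X} (hx : ∀ t : E n, t +ᵥ x = x) :
    infConv n L F x = F x :=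
  le_antisymm (infConv_le hL hF x) (le_infConv fun t => by
    rw [hx]; exact le_add_of_nonneg_right (by positivity))

theorem orbitLip_infConv (hL : 0 ≤ L) (hF : ∀ x, 0 ≤ F x) : OrbitLip n L (infConv n L F) :=
  OrbitLip.of_le fun t x => by
    rw [← sub_le_iff_le_add]
    refine le_infConv fun s => ?_
    have h1 := infConv_le_add hL hF (t +ᵥ x) (s - t)
    rw [vadd_vadd, sub_add_cancel] at h1
    have h2 : L * ‖s - t‖ ≤ L * (‖s‖ + ‖t‖) := by gcongr; exact norm_sub_le _ _
    linarith

/-- If `F` is `1`-Lipschitz along orbits with values in `[0, 1]`, then the infimal convolution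
with a cone of slope `1 - δ` is `2δ`-close to `F`. -/
theorem sub_le_infConv {δ : ℝ} (hδ : 0 ≤ δ) (hδ' : δ ≤ 1 / 2) (hF : ∀ x, F x ∈ Set.Icc 0 1)
    (hFL : OrbitLip n 1 F) (x : X) : F x - 2 * δ ≤ infConv n (1 - δ) F x := by
  refine le_infConv fun t => ?_
  have h1 := neg_le_of_abs_le (hFL t x)
  -- For `‖t‖ ≤ 2` the loss of slope costs at most `2δ`; beyond that the cone alone is at least `1 ≥
  -- F x`, as `1 - δ ≥ 1/2`.
  rcases le_total ‖t‖ 2 with h | h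
  · nlinarith
  · have := (hF (t +ᵥ x)).1
    have := (hF x).2
    nlinarith

/-- Since `F ≤ 1`, vectors longer than `1 / L` cannot beat `t = 0`, so the infimum runs over a
compact ball. -/
theorem continuous_infConv [TopologicalSpace X] [ContinuousVAdd (E n) X] (hL : 0 < L)
    (hc : Continuous F) (hF : ∀ x, F x ∈ Set.Icc 0 1) : Continuous (infConv n L F) := by
  let f : X → E n → ℝ := fun x t => F (t +ᵥ x) + L * ‖t‖
  have hf : Continuous (Function.uncurry f) := by
    change Continuous fun w : X × E n => F (w.2 +ᵥ w.1) + L * ‖w.2‖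
    fun_prop
  have key := IsCompact.continuous_sInf (f := f) (isCompact_closedBall (0 : E n) (1 / L)) hf
  convert key using 1
  funext x
  have hb : BddBelow (f x '' Metric.closedBall (0 : E n) (1 / L)) :=
    ⟨0, by rintro _ ⟨t, -, rfl⟩; have := (hF (t +ᵥ x)).1; positivity⟩
  have h0 : (0 : E n) ∈ Metric.closedBall (0 : E n) (1 / L) :=
    Metric.mem_closedBall_self (by positivity)
  refine le_antisymm (le_csInf ⟨_, 0, h0, rfl⟩ ?_) (le_infConv fun t => ?_)
  · rintro _ ⟨t, -, rfl⟩
    exact infConv_le_add hL.le (fun x => (hF x).1) x t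
  · by_cases ht : t ∈ Metric.closedBall (0 : E n) (1 / L)
    · exact csInf_le hb ⟨t, ht, rfl⟩
    · refine (csInf_le hb ⟨0, h0, rfl⟩).trans ?_
      rw [mem_closedBall_zero_iff, not_le, div_lt_iff₀ hL] at ht
      have h1 := (hF (t +ᵥ x)).1
      have h2 := (hF x).2
      simp only [f, zero_vadd, norm_zero, mul_zero, add_zero]
      nlinarith

end OrbitLip

/-! ### The bump function -/

/-- Near a non-fixed point `p` and a point `q ≠ p` there is a direction `v` and a bump function,
Lipschitz along orbits, which varies along `v` near `p` and vanishes near `q`. -/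
theorem exists_bump {n : ℕ} {X : Type*} [TopologicalSpace X] [CompactSpace X] [T2Space X]
    [AddAction (E n) X] [ContinuousVAdd (E n) X] {p q : X} (hp : p ∉ stratum n X n)
    (hpq : p ≠ q) :
    ∃ (v : E n) (L : ℝ) (z : X → ℝ), 0 < L ∧ Continuous z ∧ OrbitLip n L z ∧
      (∀ x, z x ∈ Set.Icc 0 1) ∧ (∀ x ∈ stratum n X n, z x = 0) ∧
      (∀ᶠ x in 𝓝 p, 1 / 2 ≤ z x ∧ z (v +ᵥ x) = 0) ∧
      ∀ᶠ y in 𝓝 q, ∀ τ ∈ Set.Icc (0 : ℝ) 2, z ((τ • v) +ᵥ y) = 0 := by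
  have hball : ∀ y : X, y ≠ p → ∃ ρ > 0, ∀ t : E n, ‖t‖ ≤ ρ → t +ᵥ y ≠ p := by
    intro y hy
    have ho : {t : E n | t +ᵥ y ≠ p} ∈ 𝓝 (0 : E n) :=
      (isOpen_ne_fun (by fun_prop) continuous_const).mem_nhds (by simpa using hy)
    obtain ⟨ρ, hρ, h⟩ := Metric.nhds_basis_closedBall.mem_iff.1 ho
    exact ⟨ρ, hρ, fun t ht => h (by simpa using ht)⟩
  obtain ⟨ρ, hρ, hq⟩ := hball q hpq.symm
  -- With `‖v‖ < ρ / 4`, a shift by `τ • v` with `τ ≤ 2` followed by one of length at most `l ≤ ρ /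
  -- 2` stays in the `ρ`-ball that avoids `p`.
  obtain ⟨v, hv, hvp⟩ := exists_norm_lt_vadd_ne hp (show 0 < ρ / 4 by positivity)
  obtain ⟨ρ', hρ', hp'⟩ := hball _ hvp
  let l := min (ρ / 2) ρ'
  have hl : 0 < l := by positivity
  let K : Set X := ((fun t : E n => t +ᵥ q) '' Metric.closedBall 0 ρ) ∪
    ((fun t : E n => t +ᵥ (v +ᵥ p)) '' Metric.closedBall 0 l) ∪ stratum n X n
  have hK : IsClosed K := by
    refine IsClosed.union (IsClosed.union ?_ ?_) (isClosed_stratum n)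
    · exact ((isCompact_closedBall _ _).image (by fun_prop)).isClosed
    · exact ((isCompact_closedBall _ _).image (by fun_prop)).isClosed
  have hpK : p ∉ K := by
    rintro ((⟨t, ht, h⟩ | ⟨t, ht, h⟩) | h)
    · exact hq t (by simpa using ht) h
    · exact hp' t ((mem_closedBall_zero_iff.1 ht).trans (min_le_right _ _)) h
    · exact hp h
  obtain ⟨h0, hh0, hh1, hI⟩ := exists_continuous_zero_one_of_isClosed
    (isClosed_singleton (x := p)) hK (Set.disjoint_singleton_left.2 hpK)
  have hnn : ∀ x, 0 ≤ h0 x := fun x => (hI x).1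
  have hL : 0 < 1 / l := by positivity
  set h := infConv n (1 / l) h0 with hdef
  have hc : Continuous h := continuous_infConv hL h0.continuous hI
  have hlip : OrbitLip n (1 / l) h := orbitLip_infConv hL.le hnn
  -- Within distance `l` one has `h0 = 1`; further out the cone of slope `1 / l` already contributes
  -- 1.
  have hge : ∀ w : X, (∀ t : E n, ‖t‖ ≤ l → t +ᵥ w ∈ K) → 1 ≤ h w := by
    intro w hw
    refine le_infConv fun t => ?_
    rcases le_total ‖t‖ l with ht | ht
    · have : h0 (t +ᵥ w) = 1 := hh1 (hw t ht)
      rw [this]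
      exact le_add_of_nonneg_right (by positivity)
    · have h1 : 1 ≤ 1 / l * ‖t‖ := by
        rw [one_div, ← div_eq_inv_mul, le_div_iff₀ hl]; linarith
      linarith [hnn (t +ᵥ w)]
  have hpz : h p = 0 := le_antisymm ((infConv_le hL.le hnn p).trans_eq (hh0 rfl))
    (infConv_nonneg hL.le hnn p)
  -- Truncation turns `h ≥ 1/2` into exact vanishing, so `z` vanishes on whole neighbourhoods of
  -- points where `h ≥ 1`.
  refine ⟨v, 2 * (1 / l), fun x => max 0 (1 - 2 * h x), by positivity, by fun_prop, ?_, ?_, ?_,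
    ?_, ?_⟩
  · intro t x
    refine (abs_max_sub_max_le_max _ _ _ _).trans (max_le ?_ ?_)
    · simp only [sub_self, abs_zero]; positivity
    · have := hlip t x
      rw [show 1 - 2 * h (t +ᵥ x) - (1 - 2 * h x) = -(2 * (h (t +ᵥ x) - h x)) by ring, abs_neg,
        abs_mul, abs_two, mul_assoc]
      gcongr
  · exact fun x => ⟨le_max_left _ _, max_le zero_le_one
      (by linarith [infConv_nonneg (n := n) hL.le hnn x])⟩
  · intro x hx
    have := hge x fun t _ => by rw [vadd_eq_of_mem_stratum_top hx]; exact Or.inr hx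
    exact max_eq_left (by linarith)
  · have h1 : ∀ᶠ x in 𝓝 p, h x < 1 / 4 :=
      hc.continuousAt.eventually_lt_const (by rw [hpz]; norm_num)
    have h2 : ∀ᶠ x in 𝓝 p, 1 / 2 < h (v +ᵥ x) := by
      refine (hc.comp (continuous_const_vadd v)).continuousAt.eventually_const_lt ?_
      refine lt_of_lt_of_le (by norm_num) (hge (v +ᵥ p) fun t ht => ?_)
      exact Or.inl (Or.inr ⟨t, by simpa using ht, rfl⟩)
    filter_upwards [h1, h2] with x hx1 hx2
    exact ⟨le_max_of_le_right (by linarith), max_eq_left (by linarith)⟩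
  · refine IsCompact.eventually_forall_of_forall_eventually isCompact_Icc fun τ hτ => ?_
    have hc' : Continuous fun w : X × ℝ => h ((w.2 • v) +ᵥ w.1) := by fun_prop
    have h1 : 1 / 2 < h ((τ • v) +ᵥ q) := by
      refine lt_of_lt_of_le (by norm_num) (hge _ fun t ht => Or.inl (Or.inl ⟨t + τ • v, ?_, ?_⟩))
      · rw [mem_closedBall_zero_iff]
        have h1 : ‖τ • v‖ ≤ 2 * (ρ / 4) := by
          rw [norm_smul, Real.norm_of_nonneg hτ.1]
          exact mul_le_mul hτ.2 hv.le (norm_nonneg _) (by norm_num)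
        have h2 : l ≤ ρ / 2 := min_le_left _ _
        linarith [norm_add_le t (τ • v)]
      · exact add_vadd _ _ _
    filter_upwards [hc'.continuousAt.eventually_const_lt h1] with w hw
    exact max_eq_left (by linarith)

/-! ### Averaging along orbit segments -/

section OrbitAverage

variable {n : ℕ} {X : Type*} [AddAction (E n) X]

/-- The average of `F` over the orbit segment `{s v + x | 0 ≤ s ≤ r}`. -/
noncomputable def orbitAvg {n : ℕ} {X : Type*} [AddAction (E n) X] (r : ℝ) (v : E n)
    (F : X → ℝ) (x : X) : ℝ :=
  r⁻¹ * ∫ s in (0 : ℝ)..r, F ((s • v) +ᵥ x)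

variable {r L : ℝ} {v : E n} {F : X → ℝ}

theorem orbitAvg_const_of_forall {x : X} {c : ℝ} (hr : 0 < r)
    (h : ∀ s ∈ Set.Icc 0 r, F ((s • v) +ᵥ x) = c) : orbitAvg r v F x = c := by
  rw [orbitAvg, intervalIntegral.integral_congr (g := fun _ => c), intervalIntegral.integral_const]
  · simp [hr.ne']
  · intro s hs
    exact h s (by rwa [Set.uIcc_of_le hr.le] at hs)

/-- The compared expressions are derivatives of the averaged function along `v`
(`hasDerivAt_orbitAvg`): averaging makes a Lipschitz function `C^{1,1}` in this direction. -/
theorem abs_deriv_orbitAvg_sub_le (hr : 0 < r) (hL : OrbitLip n L F) (x : X) (τ τ' : ℝ) :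
    |r⁻¹ * (F (((τ + r) • v) +ᵥ x) - F ((τ • v) +ᵥ x)) -
      r⁻¹ * (F (((τ' + r) • v) +ᵥ x) - F ((τ' • v) +ᵥ x))| ≤
      r⁻¹ * (2 * L * ‖v‖) * |τ - τ'| := by
  have h : ∀ a b : ℝ, |F ((a • v) +ᵥ x) - F ((b • v) +ᵥ x)| ≤ L * (|a - b| * ‖v‖) := by
    intro a b
    have := hL ((a - b) • v) ((b • v) +ᵥ x)
    rwa [vadd_vadd, ← add_smul, sub_add_cancel, norm_smul, Real.norm_eq_abs] at this
  have h1 := h (τ + r) (τ' + r)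
  have h2 := h τ τ'
  rw [add_sub_add_right_eq_sub] at h1
  rw [← mul_sub, abs_mul, abs_of_pos (inv_pos.2 hr), mul_assoc]
  gcongr
  rw [sub_sub_sub_comm]
  refine (abs_sub _ _).trans ?_
  linarith

variable [TopologicalSpace X] [ContinuousVAdd (E n) X]

theorem continuous_smul_vadd (v : E n) (x : X) : Continuous fun s : ℝ => (s • v) +ᵥ x := by
  fun_prop

theorem intervalIntegrable_orbit (hF : Continuous F) (v : E n) (x : X) (a b : ℝ) :
    IntervalIntegrable (fun s : ℝ => F ((s • v) +ᵥ x)) MeasureTheory.volume a b :=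
  (hF.comp (continuous_smul_vadd v x)).intervalIntegrable a b

theorem continuous_orbitAvg (hF : Continuous F) : Continuous (orbitAvg r v F) := by
  refine continuous_const.mul
    (intervalIntegral.continuous_parametric_intervalIntegral_of_continuous' ?_ 0 r)
  change Continuous fun w : X × ℝ => F ((w.2 • v) +ᵥ w.1)
  fun_prop

theorem orbitAvg_mono {G : X → ℝ} (hr : 0 < r) (hF : Continuous F) (hG : Continuous G)
    {x y : X} (h : ∀ s ∈ Set.Icc 0 r, F ((s • v) +ᵥ x) ≤ G ((s • v) +ᵥ y)) :
    orbitAvg r v F x ≤ orbitAvg r v G y :=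
  mul_le_mul_of_nonneg_left (intervalIntegral.integral_mono_on hr.le
    (intervalIntegrable_orbit hF v x 0 r) (intervalIntegrable_orbit hG v y 0 r) h)
    (inv_nonneg.2 hr.le)

theorem orbitAvg_add_mul (hr : 0 < r) (hF : Continuous F) (a b : ℝ) (x : X) :
    orbitAvg r v (fun x => a + b * F x) x = a + b * orbitAvg r v F x := by
  rw [orbitAvg, orbitAvg, intervalIntegral.integral_add (by simp)
    ((intervalIntegrable_orbit hF v x 0 r).const_mul b), intervalIntegral.integral_const_mul,
    intervalIntegral.integral_const, sub_zero, smul_eq_mul]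
  field_simp

/-- Translations commute, so averaging does not increase the Lipschitz constant. -/
theorem orbitLip_orbitAvg (hr : 0 < r) (hF : Continuous F) (hL : OrbitLip n L F) :
    OrbitLip n L (orbitAvg r v F) :=
  OrbitLip.of_le fun t x => by
    have hc : Continuous fun x => L * ‖t‖ + 1 * F x := by fun_prop
    have := orbitAvg_mono (v := v) hr hF hc (x := t +ᵥ x) (y := x) fun s _ => by
      rw [vadd_comm]
      linarith [le_of_abs_le (hL t ((s • v) +ᵥ x))]
    rw [orbitAvg_add_mul hr hF] at this
    linarith

theorem abs_orbitAvg_sub_le (hr : 0 < r) (hF : Continuous F) (hL0 : 0 ≤ L) (hL : OrbitLip n L F)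
    (x : X) : |orbitAvg r v F x - F x| ≤ L * (r * ‖v‖) := by
  have h : ∀ s ∈ Set.Icc 0 r, |F ((s • v) +ᵥ x) - F x| ≤ L * (r * ‖v‖) := fun s hs =>
    (hL _ x).trans (by
      rw [norm_smul, Real.norm_of_nonneg hs.1]
      have := hs.2
      gcongr)
  have h1 := orbitAvg_mono (v := v) hr hF (continuous_const (y := F x + L * (r * ‖v‖)))
    (x := x) (y := x) fun s hs => by linarith [le_of_abs_le (h s hs)]
  have h2 := orbitAvg_mono (v := v) hr (continuous_const (y := F x - L * (r * ‖v‖))) hF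
    (x := x) (y := x) fun s hs => by linarith [neg_le_of_abs_le (h s hs)]
  rw [orbitAvg_const_of_forall (F := fun _ => _) hr fun _ _ => rfl] at h1 h2
  exact abs_le.2 ⟨by linarith, by linarith⟩

theorem hasDerivAt_orbitAvg (hF : Continuous F) (x : X) (τ : ℝ) :
    HasDerivAt (fun τ : ℝ => orbitAvg r v F ((τ • v) +ᵥ x))
      (r⁻¹ * (F (((τ + r) • v) +ᵥ x) - F ((τ • v) +ᵥ x))) τ := by
  let φ : ℝ → ℝ := fun s => F ((s • v) +ᵥ x)
  have hφ : Continuous φ := hF.comp (continuous_smul_vadd v x)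
  have hΦ : ∀ b : ℝ, HasDerivAt (fun u => ∫ s in (0 : ℝ)..u, φ s) (φ b) b := fun b =>
    intervalIntegral.integral_hasDerivAt_right (hφ.intervalIntegrable _ _)
      (hφ.stronglyMeasurableAtFilter _ _) hφ.continuousAt
  have key : (fun τ : ℝ => orbitAvg r v F ((τ • v) +ᵥ x)) =
      fun τ => r⁻¹ * ((∫ s in (0 : ℝ)..(τ + r), φ s) - ∫ s in (0 : ℝ)..τ, φ s) := by
    funext τ
    rw [intervalIntegral.integral_interval_sub_left (hφ.intervalIntegrable _ _)
      (hφ.intervalIntegrable _ _)]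
    have := intervalIntegral.integral_comp_add_right (a := 0) (b := r) φ τ
    rw [zero_add, add_comm r] at this
    rw [← this, orbitAvg]
    simp only [φ, add_smul, add_vadd]
  rw [key]
  exact (((hΦ (τ + r)).comp_add_const τ r).sub (hΦ τ)).const_mul _

end OrbitAverage

/-! ### One-variable oscillation estimates -/

section Oscillation

/-- A function with Lipschitz derivative oscillates little on short intervals. -/
theorem two_mul_le_of_oscillation {w w' : ℝ → ℝ} {C A : ℝ} (hA : 0 < A)
    (hd : ∀ τ, HasDerivAt w (w' τ) τ) (hC : ∀ τ τ', |w' τ - w' τ'| ≤ C * |τ - τ'|)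
    {a b c : ℝ} (hab : a < b) (hbc : b < c) (ha : w a = 0) (hb : w b = A) (hc : w c = 0) :
    2 * A ≤ C * (c - a) ^ 2 := by
  have hcont : Continuous w := continuous_iff_continuousAt.2 fun τ => (hd τ).continuousAt
  -- The mean value theorem gives a slope at least `A / (c - a)` on the rise and at most its
  -- negative on the fall.
  obtain ⟨ξ, hξ, h1⟩ := exists_hasDerivAt_eq_slope w w' hab hcont.continuousOn fun τ _ => hd τ
  obtain ⟨η, hη, h2⟩ := exists_hasDerivAt_eq_slope w w' hbc hcont.continuousOn fun τ _ => hd τ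
  have hl : 0 < c - a := by linarith
  have hξ' : A / (c - a) ≤ w' ξ := by
    rw [h1, ha, hb, sub_zero]
    have : 0 < b - a := by linarith
    gcongr
  have hη' : w' η ≤ -(A / (c - a)) := by
    rw [h2, hc, hb, zero_sub, neg_div, neg_le_neg_iff]
    have : 0 < c - b := by linarith
    gcongr
  have hlen : |ξ - η| ≤ c - a := abs_le.2 ⟨by linarith [hξ.1, hη.2], by linarith [hξ.2, hη.1]⟩
  have h3 := (le_abs_self _).trans (hC ξ η)
  have hC0 : 0 ≤ C := by
    have := (abs_nonneg _).trans (hC 1 0)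
    simpa using this
  have h4 : 2 * (A / (c - a)) ≤ C * (c - a) := by
    have : C * |ξ - η| ≤ C * (c - a) := by gcongr
    linarith
  have h5 : A / (c - a) * (c - a) = A := div_mul_cancel₀ _ hl.ne'
  nlinarith

/-- A function with `z 0 - z 1 ≥ c` drops by at least `c / m` on one of the `m`
intervals of length `1 / m` in `[0, 1]`. -/
theorem exists_drop {z : ℝ → ℝ} {c : ℝ} (h : c ≤ z 0 - z 1) {m : ℕ} (hm : 0 < m) :
    ∃ α ∈ Set.Icc (0 : ℝ) 1, ∃ β ∈ Set.Icc (0 : ℝ) 1, α < β ∧ β - α = 1 / m ∧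
      c / m ≤ z α - z β := by
  have hm' : (0 : ℝ) < m := Nat.cast_pos.2 hm
  have hs : ∑ i ∈ Finset.range m, (z ((i : ℕ) / m) - z ((i + 1 : ℕ) / m)) = z 0 - z 1 := by
    rw [Finset.sum_range_sub' (fun i : ℕ => z (i / m))]
    simp [hm'.ne']
  obtain ⟨i, hi, hle⟩ := Finset.exists_le_of_sum_le (s := Finset.range m)
    (f := fun _ => c / m) (g := fun i : ℕ => z ((i : ℕ) / m) - z ((i + 1 : ℕ) / m))
    (by simpa using hm.ne') (by
      rw [hs, Finset.sum_const, Finset.card_range, nsmul_eq_mul, mul_div_cancel₀ _ hm'.ne']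
      exact h)
  have hi' : ((i + 1 : ℕ) : ℝ) ≤ m := Nat.cast_le.2 (Finset.mem_range.1 hi)
  have hlen : ((i + 1 : ℕ) : ℝ) / m - (i : ℝ) / m = 1 / m := by push_cast; ring
  have hpos : (0 : ℝ) < 1 / m := by positivity
  have h1 : ((i + 1 : ℕ) : ℝ) / m ≤ 1 := (div_le_one hm').2 hi'
  have h0 : (0 : ℝ) ≤ (i : ℝ) / m := by positivity
  exact ⟨(i : ℝ) / m, ⟨h0, by linarith⟩, ((i + 1 : ℕ) : ℝ) / m, ⟨by positivity, h1⟩,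
    by linarith, hlen, hle⟩

/-- A continuous function dropping by `4π` on `[α, β]` makes `1 - cos` oscillate fully there. -/
theorem exists_cos_oscillation {g : ℝ → ℝ} (hg : Continuous g) {α β : ℝ} (hαβ : α < β)
    (h : 4 * Real.pi ≤ g α - g β) :
    ∃ a b c : ℝ, α ≤ a ∧ a < b ∧ b < c ∧ c ≤ β ∧ Real.cos (g a) = 1 ∧ Real.cos (g b) = -1 ∧
      Real.cos (g c) = 1 := by
  have hpi := Real.pi_pos
  -- For the largest multiple `2πj ≤ g α`, the levels `2πj`, `2πj - π`, `2πj - 2π` all lie in `[g β,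
  -- g α]`.
  obtain ⟨j, hj1, hj2⟩ : ∃ j : ℤ, g α - 2 * Real.pi < j * (2 * Real.pi) ∧
      j * (2 * Real.pi) ≤ g α := by
    refine ⟨⌊g α / (2 * Real.pi)⌋, ?_, ?_⟩
    · have := Int.lt_floor_add_one (g α / (2 * Real.pi))
      rw [div_lt_iff₀ (by positivity)] at this
      linarith
    · exact (le_div_iff₀ (by positivity)).1 (Int.floor_le _)
  have ivt : ∀ {s y : ℝ}, s ≤ β → y ≤ g s → g β ≤ y → ∃ u, s ≤ u ∧ u ≤ β ∧ g u = y := by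
    intro s y hs h1 h2
    obtain ⟨u, hu, rfl⟩ := intermediate_value_Icc' hs hg.continuousOn ⟨h2, h1⟩
    exact ⟨u, hu.1, hu.2, rfl⟩
  obtain ⟨a, ha1, ha2, ha⟩ := ivt hαβ.le hj2 (by linarith)
  obtain ⟨b, hb1, hb2, hb⟩ := ivt (y := j * (2 * Real.pi) - Real.pi) ha2 (by linarith)
    (by linarith)
  obtain ⟨c, hc1, hc2, hc⟩ := ivt (y := j * (2 * Real.pi) - 2 * Real.pi) hb2 (by linarith)
    (by linarith)
  refine ⟨a, b, c, ha1, lt_of_le_of_ne hb1 ?_, lt_of_le_of_ne hc1 ?_, hc2, ?_, ?_, ?_⟩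
  · rintro rfl; linarith
  · rintro rfl; linarith
  · rw [ha]; exact Real.cos_int_mul_two_pi j
  · rw [hb, Real.cos_sub_pi, Real.cos_int_mul_two_pi]
  · rw [hc, Real.cos_sub_two_pi, Real.cos_int_mul_two_pi]

end Oscillation

/-! ### Perturbation and density -/

section Density

variable {n : ℕ} {X : Type*} [TopologicalSpace X] [AddAction (E n) X] [ContinuousVAdd (E n) X]

/-- A function `F` which is `1`-Lipschitz along orbits can be perturbed, without changing it at
fixed points, so as to separate the orbits of points `x` along which the bump function `z` varies
from the orbits of points `y` along which it vanishes. -/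
theorem exists_perturbation {v : E n} {L : ℝ} {z : X → ℝ} (hL : 0 < L) (hz : Continuous z)
    (hzL : OrbitLip n L z) (hzI : ∀ x, z x ∈ Set.Icc 0 1) (hzfix : ∀ x ∈ stratum n X n, z x = 0)
    {F : X → ℝ} (hF : Continuous F) (hFL : OrbitLip n 1 F) (hFI : ∀ x, F x ∈ Set.Icc 0 1)
    {ε : ℝ} (hε : 0 < ε) :
    ∃ G : X → ℝ, Continuous G ∧ OrbitLip n 1 G ∧ (∀ x, G x ∈ Set.Icc 0 1) ∧
      (∀ x ∈ stratum n X n, G x = F x) ∧ (∀ x, |G x - F x| ≤ ε) ∧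
      ∀ x y, 1 / 2 ≤ z x → z (v +ᵥ x) = 0 →
        (∀ τ ∈ Set.Icc (0 : ℝ) 2, z ((τ • v) +ᵥ y) = 0) →
        ∃ t : E n, G (t +ᵥ x) ≠ G (t +ᵥ y) := by
  have hpi := Real.pi_pos
  -- `δ` is the slope freed: half pays for the factor `1 - κ z`, half for the ripple. Each of the
  -- four modifications costs at most `ε / 4`.
  obtain ⟨δ, hδ, hδ2, hδε⟩ : ∃ δ : ℝ, 0 < δ ∧ δ ≤ 1 / 2 ∧ 2 * δ ≤ ε / 4 :=
    ⟨min (1 / 2) (ε / 8), by positivity, min_le_left _ _, by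
      linarith [min_le_right (1 / 2) (ε / 8)]⟩
  obtain ⟨κ, hκ, hκ1, hκε, hκL⟩ : ∃ κ : ℝ, 0 < κ ∧ κ ≤ 1 ∧ κ ≤ ε / 4 ∧ κ * L ≤ δ / 2 := by
    refine ⟨min (min 1 (ε / 4)) (δ / 2 / L), by positivity, ?_, ?_, ?_⟩
    · exact (min_le_left _ _).trans (min_le_left _ _)
    · exact (min_le_left _ _).trans (min_le_right _ _)
    · rw [← le_div_iff₀ hL]
      exact min_le_right _ _
  obtain ⟨r, hr, hr1, hrε, hrL⟩ : ∃ r : ℝ, 0 < r ∧ r ≤ 1 ∧ r * ‖v‖ ≤ ε / 4 ∧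
      L * (r * ‖v‖) ≤ 1 / 8 := by
    have hv : 0 < ‖v‖ + 1 := by positivity
    let c := min (ε / 4) (1 / 8 / L) / (‖v‖ + 1)
    have hc : 0 < c := by positivity
    have h1 : min 1 c * ‖v‖ ≤ min (ε / 4) (1 / 8 / L) := by
      calc min 1 c * ‖v‖ ≤ c * (‖v‖ + 1) := by
            gcongr
            · exact min_le_right _ _
            · linarith
        _ = _ := div_mul_cancel₀ _ hv.ne'
    refine ⟨min 1 c, by positivity, min_le_left _ _, h1.trans (min_le_left _ _), ?_⟩
    rw [mul_comm, ← le_div_iff₀ hL]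
    exact h1.trans (min_le_right _ _)
  obtain ⟨μ, hμ, hμκ, hμL⟩ : ∃ μ : ℝ, 0 < μ ∧ μ ≤ κ ∧ μ * L ≤ δ :=
    ⟨min κ (δ / L), by positivity, min_le_left _ _, by
      rw [← le_div_iff₀ hL]; exact min_le_right _ _⟩
  -- Lipschitz constant of the derivative of a difference of two averaged orbit functions; it does
  -- not depend on `m`.
  let C : ℝ := 2 * (r⁻¹ * (2 * 1 * ‖v‖))
  obtain ⟨m, hm⟩ := exists_nat_gt (max 1 (8 * Real.pi * C / μ))
  have hm1 : (1 : ℝ) < m := (le_max_left _ _).trans_lt hm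
  have hm0 : (0 : ℝ) < m := zero_lt_one.trans hm1
  have hmC : 8 * Real.pi * C < m * μ := (div_lt_iff₀ hμ).1 ((le_max_right _ _).trans_lt hm)
  -- The averaged bump drops by `1 / (4m)` on some interval of length `1 / m`; this `N` turns that
  -- into a phase drop of `4π`.
  let N : ℝ := 16 * Real.pi * m
  have hN : 0 < N := by positivity
  have hN1 : 1 ≤ N := by
    have := Real.pi_gt_three
    change 1 ≤ 16 * Real.pi * m
    nlinarith
  let A : ℝ := μ / N
  have hA : 0 < A := by positivity
  have hAN : A * N = μ := div_mul_cancel₀ _ hN.ne'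
  have hAμ : A ≤ μ := div_le_self hμ.le hN1
  have hnn : ∀ x, 0 ≤ F x := fun x => (hFI x).1
  have hδ1 : 0 < 1 - δ := by linarith
  let F₁ : X → ℝ := infConv n (1 - δ) F
  have h1c : Continuous F₁ := continuous_infConv hδ1 hF hFI
  have h1L : OrbitLip n (1 - δ) F₁ := orbitLip_infConv hδ1.le hnn
  have h1le : ∀ x, F₁ x ≤ F x := infConv_le hδ1.le hnn
  have h1ge : ∀ x, F x - 2 * δ ≤ F₁ x := sub_le_infConv hδ.le hδ2 hFI hFL
  have h1nn : ∀ x, 0 ≤ F₁ x := infConv_nonneg hδ1.le hnn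
  have h11 : ∀ x, F₁ x ≤ 1 := fun x => (h1le x).trans (hFI x).2
  -- Multiplying, rather than subtracting, makes room below 1 without leaving `[0, 1]` at the
  -- bottom.
  let F₂ : X → ℝ := fun x => F₁ x * (1 - κ * z x)
  have h2c : Continuous F₂ := by fun_prop
  have hκz : ∀ x, 0 ≤ κ * z x ∧ κ * z x ≤ κ := fun x =>
    ⟨mul_nonneg hκ.le (hzI x).1, mul_le_of_le_one_right hκ.le (hzI x).2⟩
  have h2L : OrbitLip n (1 - δ / 2) F₂ := fun t x => by
    have e : F₂ (t +ᵥ x) - F₂ x = (F₁ (t +ᵥ x) - F₁ x) * (1 - κ * z (t +ᵥ x)) -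
        F₁ x * (κ * (z (t +ᵥ x) - z x)) := by ring
    have i1 : |(F₁ (t +ᵥ x) - F₁ x) * (1 - κ * z (t +ᵥ x))| ≤ (1 - δ) * ‖t‖ := by
      rw [abs_mul]
      refine (mul_le_of_le_one_right (abs_nonneg _) ?_).trans (h1L t x)
      exact abs_le.2 ⟨by linarith [hκz (t +ᵥ x)], by linarith [hκz (t +ᵥ x)]⟩
    have i2 : |F₁ x * (κ * (z (t +ᵥ x) - z x))| ≤ κ * (L * ‖t‖) := by
      rw [abs_mul, abs_mul, abs_of_pos hκ, abs_of_nonneg (h1nn x)]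
      refine (mul_le_of_le_one_left (by positivity) (h11 x)).trans ?_
      gcongr
      exact hzL t x
    rw [e]
    refine (abs_sub _ _).trans ((add_le_add i1 i2).trans ?_)
    rw [← mul_assoc, ← add_mul]
    gcongr
    linarith
  have h2nn : ∀ x, 0 ≤ F₂ x := fun x =>
    mul_nonneg (h1nn x) (by linarith [hκz x])
  have h2le : ∀ x, F₂ x ≤ 1 + -κ * z x := fun x => by
    have := mul_le_of_le_one_left (show 0 ≤ 1 - κ * z x by linarith [hκz x]) (h11 x)
    linarith
  have h21 : ∀ x, |F₂ x - F₁ x| ≤ κ := fun x => by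
    have e : F₂ x - F₁ x = -(F₁ x * (κ * z x)) := by ring
    rw [e, abs_neg, abs_of_nonneg (mul_nonneg (h1nn x) (hκz x).1)]
    exact (mul_le_of_le_one_left (hκz x).1 (h11 x)).trans (hκz x).2
  let F₃ : X → ℝ := orbitAvg r v F₂
  have h3c : Continuous F₃ := continuous_orbitAvg h2c
  have h3L : OrbitLip n (1 - δ / 2) F₃ := orbitLip_orbitAvg hr h2c h2L
  have h32 : ∀ x, |F₃ x - F₂ x| ≤ ε / 4 := fun x =>
    (abs_orbitAvg_sub_le hr h2c (by linarith) h2L x).trans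
      ((mul_le_of_le_one_left (by positivity) (by linarith)).trans hrε)
  let ζ : X → ℝ := orbitAvg r v z
  have hζc : Continuous ζ := continuous_orbitAvg hz
  have hζL : OrbitLip n L ζ := orbitLip_orbitAvg hr hz hzL
  have hζz : ∀ x, |ζ x - z x| ≤ 1 / 8 := fun x =>
    (abs_orbitAvg_sub_le hr hz hL.le hzL x).trans hrL
  have hconst : ∀ (c : ℝ) (x : X), orbitAvg r v (fun _ : X => c) x = c := fun c x =>
    orbitAvg_const_of_forall hr fun _ _ => rfl
  have hζ0 : ∀ x, 0 ≤ ζ x := fun x => by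
    rw [← hconst 0 x]
    exact orbitAvg_mono hr continuous_const hz fun s _ => (hzI _).1
  have h3nn : ∀ x, 0 ≤ F₃ x := fun x => by
    rw [← hconst 0 x]
    exact orbitAvg_mono hr continuous_const h2c fun s _ => h2nn _
  have h3le : ∀ x, F₃ x ≤ 1 + -κ * ζ x := fun x => by
    rw [← orbitAvg_add_mul hr hz]
    exact orbitAvg_mono hr h2c (by fun_prop) fun s _ => h2le _
  let u : X → ℝ := fun x => A / 2 * (1 - Real.cos (N * ζ x))
  have hu0 : ∀ x, 0 ≤ u x := fun x =>
    mul_nonneg (by positivity) (by linarith [Real.cos_le_one (N * ζ x)])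
  have hu1 : ∀ x, u x ≤ A := fun x => by
    have := mul_le_mul_of_nonneg_left
      (show 1 - Real.cos (N * ζ x) ≤ 2 by linarith [Real.neg_one_le_cos (N * ζ x)])
      (show 0 ≤ A / 2 by positivity)
    change A / 2 * _ ≤ A
    linarith
  have hucos : ∀ x y, |u x - u y| ≤ μ / 2 * |ζ x - ζ y| := fun x y => by
    have e : u x - u y = A / 2 * (Real.cos (N * ζ y) - Real.cos (N * ζ x)) := by ring
    rw [e, abs_mul, abs_of_pos (show 0 < A / 2 by positivity)]
    have := Real.abs_cos_sub_cos_le (N * ζ y) (N * ζ x)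
    rw [← mul_sub, abs_mul, abs_of_pos hN, abs_sub_comm (ζ y)] at this
    calc A / 2 * _ ≤ A / 2 * (N * |ζ x - ζ y|) := by gcongr
      _ = A * N / 2 * |ζ x - ζ y| := by ring
      _ = _ := by rw [hAN]
  have huζ0 : ∀ x, ζ x = 0 → u x = 0 := fun x hx => by simp [u, hx]
  have huζ : ∀ x, u x ≤ κ * ζ x := fun x => by
    have h := Real.abs_cos_sub_cos_le 0 (N * ζ x)
    rw [Real.cos_zero, zero_sub, abs_neg, abs_of_nonneg (mul_nonneg hN.le (hζ0 x))] at h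
    have h' := (le_abs_self _).trans h
    calc u x ≤ A / 2 * (N * ζ x) := by
          change A / 2 * _ ≤ _
          gcongr
      _ = μ / 2 * ζ x := by rw [← hAN]; ring
      _ ≤ κ * ζ x := by
          have := hζ0 x
          gcongr
          linarith
  have huL : OrbitLip n (δ / 2) u := fun t x => by
    refine (hucos _ _).trans ?_
    calc μ / 2 * |ζ (t +ᵥ x) - ζ x| ≤ μ / 2 * (L * ‖t‖) := by gcongr; exact hζL t x
      _ = μ * L / 2 * ‖t‖ := by ring
      _ ≤ δ / 2 * ‖t‖ := by gcongr
  refine ⟨fun x => F₃ x + u x, by fun_prop, (h3L.add huL).mono (by linarith), fun x => ⟨?_, ?_⟩,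
    fun x hx => ?_, fun x => ?_, fun x y hx1 hx2 hy => ?_⟩
  · exact add_nonneg (h3nn x) (hu0 x)
  -- The ripple is at most `κ * ζ`, exactly the room that survives averaging.
  · linarith [h3le x, huζ x]
  · have hfix := vadd_eq_of_mem_stratum_top hx
    have e1 : ζ x = 0 := orbitAvg_const_of_forall hr fun s _ => by rw [hfix, hzfix x hx]
    have e3 : F₃ x = F₂ x := orbitAvg_const_of_forall hr fun s _ => by rw [hfix]
    have e2 : F₂ x = F₁ x := by simp [F₂, hzfix x hx]
    have e0 : F₁ x = F x := infConv_of_fixed hδ1.le hnn hfix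
    simp only [huζ0 x e1, e3, e2, e0, add_zero]
  · have i1 := abs_le.1 (h32 x)
    have i2 := abs_le.1 (h21 x)
    have i3 := h1le x
    have i4 := h1ge x
    have i5 := hu0 x
    have i6 := hu1 x
    exact abs_le.2 ⟨by linarith, by linarith⟩
  · by_contra! hG
    -- The average looks ahead by `r ≤ 1`, hence the range `[0, 2]` in the hypothesis on `y`.
    have hζy : ∀ τ ∈ Set.Icc (0 : ℝ) 1, ζ ((τ • v) +ᵥ y) = 0 := fun τ hτ =>
      orbitAvg_const_of_forall hr fun s hs => by
        rw [vadd_vadd, ← add_smul]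
        exact hy _ ⟨by linarith [hs.1, hτ.1], by linarith [hs.2, hτ.2]⟩
    let w : ℝ → ℝ := fun τ => F₃ ((τ • v) +ᵥ y) - F₃ ((τ • v) +ᵥ x)
    have hw : ∀ τ ∈ Set.Icc (0 : ℝ) 1, w τ = A / 2 * (1 - Real.cos (N * ζ ((τ • v) +ᵥ x))) := by
      intro τ hτ
      have h := hG (τ • v)
      rw [huζ0 _ (hζy τ hτ), add_zero] at h
      change F₃ _ - F₃ _ = u _
      linarith
    have hd := fun τ => (hasDerivAt_orbitAvg (r := r) (v := v) h2c y τ).sub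
      (hasDerivAt_orbitAvg (r := r) (v := v) h2c x τ)
    have h2L1 : OrbitLip n 1 F₂ := h2L.mono (by linarith)
    have hdC := fun τ τ' => (abs_sub _ _).trans (add_le_add
      (abs_deriv_orbitAvg_sub_le (v := v) hr h2L1 y τ τ')
      (abs_deriv_orbitAvg_sub_le (v := v) hr h2L1 x τ τ'))
    have hdrop : 1 / 4 ≤ ζ (((0 : ℝ) • v) +ᵥ x) - ζ (((1 : ℝ) • v) +ᵥ x) := by
      rw [zero_smul, zero_vadd, one_smul]
      linarith [(abs_le.1 (hζz x)).1, (abs_le.1 (hζz (v +ᵥ x))).2]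
    obtain ⟨α, hα, β, hβ, hαβ, hlen, hz'⟩ := exists_drop (z := fun τ : ℝ => ζ ((τ • v) +ᵥ x)) hdrop
      (Nat.cast_pos.1 hm0)
    have hgc : Continuous fun τ : ℝ => N * ζ ((τ • v) +ᵥ x) := by fun_prop
    obtain ⟨a, b, c, ha, hab, hbc, hc, ca, cb, cc⟩ := exists_cos_oscillation hgc hαβ (by
      rw [← mul_sub]
      calc 4 * Real.pi = N * (1 / 4 / m) := by
            change _ = 16 * Real.pi * m * _
            field_simp
            norm_num
        _ ≤ _ := by gcongr)
    have key := two_mul_le_of_oscillation (w := w) (C := C) hA hd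
      (fun τ τ' => by
        have := hdC τ τ'
        rw [sub_sub_sub_comm]
        refine this.trans_eq ?_
        ring)
      hab hbc
      (by rw [hw a ⟨by linarith [hα.1], by linarith [hβ.2]⟩, ca]; ring)
      (by rw [hw b ⟨by linarith [hα.1], by linarith [hβ.2]⟩, cb]; ring)
      (by rw [hw c ⟨by linarith [hα.1], by linarith [hβ.2]⟩, cc]; ring)
    have hC0 : 0 ≤ C := by positivity
    -- With `A = μ / (16πm)` this reads `m * μ ≤ 8πC`, against the choice of `m`.
    have h1 : 2 * A ≤ C * (1 / m) ^ 2 := by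
      refine key.trans ?_
      have : 0 ≤ c - a := by linarith
      gcongr
      linarith
    have h2 : 2 * A * (8 * Real.pi * m ^ 2) = m * μ := by
      change 2 * (μ / (16 * Real.pi * m)) * _ = _
      field_simp
      ring
    have h3 : C * (1 / (m : ℝ)) ^ 2 * (8 * Real.pi * m ^ 2) = 8 * Real.pi * C := by
      field_simp
    have h4 := mul_le_mul_of_nonneg_right h1 (show 0 ≤ 8 * Real.pi * (m : ℝ) ^ 2 by positivity)
    linarith

/-- A function which is `1`-Lipschitz along orbits induces a map to `Lip₁(ℝⁿ, I)`. -/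
theorem exists_orbit_map {G : X → ℝ} (hG : Continuous G) (hGL : OrbitLip n 1 G)
    (hGI : ∀ x, G x ∈ Set.Icc 0 1) :
    ∃ g : C(X, LipOne n), ∀ (x : X) (t : E n), (g x t : ℝ) = G (t +ᵥ x) := by
  let g : X → LipOne n := fun x => ⟨fun t => ⟨G (t +ᵥ x), hGI _⟩,
    LipschitzWith.of_dist_le_mul fun s t => by
      have := hGL (s - t) (t +ᵥ x)
      rw [vadd_vadd, sub_add_cancel] at this
      rw [Subtype.dist_eq, Real.dist_eq, dist_eq_norm]
      exact this⟩
  have hc : Continuous fun w : X × E n => (⟨G (w.2 +ᵥ w.1), hGI _⟩ : unitInterval) := by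
    fun_prop
  refine ⟨⟨g, LipOne.isEmbedding_toCM.continuous_iff.2 ?_⟩, fun x t => rfl⟩
  exact (ContinuousMap.curry ⟨_, hc⟩).continuous

theorem LipOne.dist_le_of_forall {φ ψ : LipOne n} {c : ℝ}
    (h : ∀ t, |(φ t : ℝ) - ψ t| ≤ c) : dist φ ψ ≤ c := by
  refine ciSup_le fun m => ?_
  refine (mul_le_of_le_one_left (supBall_nonneg _ _ _)
    (pow_le_one₀ (by norm_num) (by norm_num))).trans (supBall_le _ _ _ fun t _ => ?_)
  rw [Subtype.dist_eq, Real.dist_eq]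
  exact h t

theorem dense_separating [CompactSpace X] (ι : stratum n X n → LipOne.level n n) {k : ℕ}
    {v : E n} {L : ℝ} {z : X → ℝ} (hL : 0 < L) (hz : Continuous z)
    (hzL : OrbitLip n L z) (hzI : ∀ x, z x ∈ Set.Icc 0 1) (hzfix : ∀ x ∈ stratum n X n, z x = 0)
    {B B' : Set X} (hB : ∀ x ∈ B, 1 / 2 ≤ z x ∧ z (v +ᵥ x) = 0)
    (hB' : ∀ y ∈ B', ∀ τ ∈ Set.Icc (0 : ℝ) 2, z ((τ • v) +ᵥ y) = 0) :
    Dense (separating ι k B B') := by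
  refine Metric.dense_iff.2 fun f ε hε => ?_
  -- Equivariance recovers `f` from its evaluation at 0.
  have hf : ∀ (x : X) (t : E n), f.1 x t = f.1 (t +ᵥ x) 0 := fun x t => by
    rw [f.2.1, LipOne.vadd_apply, zero_add]
  let F : X → ℝ := fun x => f.1 x 0
  have hFc : Continuous F := by
    have h1 : Continuous fun x => LipOne.toCM (f.1 x) 0 :=
      (ContinuousEvalConst.continuous_eval_const (F := C(E n, unitInterval)) 0).comp
        (LipOne.isEmbedding_toCM.continuous.comp f.1.continuous)
    exact continuous_subtype_val.comp h1
  have hFL : OrbitLip n 1 F := fun t x => by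
    have h := (f.1 x).2.dist_le_mul t 0
    rw [Subtype.dist_eq, Real.dist_eq, dist_zero_right] at h
    change |((f.1 x t : unitInterval) : ℝ) - (f.1 x 0 : unitInterval)| ≤ _ at h
    rwa [hf x t] at h
  obtain ⟨G, hGc, hGL, hGI, hGfix, hGF, hsep⟩ := exists_perturbation (v := v) hL hz hzL hzI hzfix
    hFc hFL (fun x => (f.1 x 0).2) (half_pos hε)
  obtain ⟨g, hg⟩ := exists_orbit_map hGc hGL hGI
  have hmem : g ∈ mapSpace ι := by
    refine ⟨fun u x => LipOne.ext' fun t => Subtype.ext ?_, fun x => ?_⟩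
    · rw [LipOne.vadd_apply, hg, hg, vadd_vadd]
    · rw [← f.2.2 x]
      refine LipOne.ext' fun t => Subtype.ext ?_
      rw [hg, hf, vadd_eq_of_mem_stratum_top x.2, hGfix _ x.2]
  refine ⟨⟨g, hmem⟩, ?_, ?_⟩
  · rw [Metric.mem_ball, Subtype.dist_eq]
    refine lt_of_le_of_lt ((ContinuousMap.dist_le (half_pos hε).le).2 fun x => ?_)
      (half_lt_self hε)
    refine LipOne.dist_le_of_forall fun t => ?_
    rw [hg, hf]
    exact hGF _
  · rintro ⟨x, y⟩ ⟨⟨hx, hy⟩, -⟩ h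
    obtain ⟨t, ht⟩ := hsep x y (hB x hx).1 (hB x hx).2 (hB' y hy)
    refine ht ?_
    rw [← hg, ← hg]
    exact congrArg (fun φ : LipOne n => (φ t : ℝ)) h

end Density

end LipFlow

/-! ### Choice of the neighbourhoods -/

theorem mainTheorem3 {n : ℕ} {X : Type*} [TopologicalSpace X] [CompactSpace X]
    [TopologicalSpace.MetrizableSpace X] [AddAction (LipFlow.E n) X]
    [ContinuousVAdd (LipFlow.E n) X]
    (ι : LipFlow.stratum n X n → LipFlow.LipOne.level n n) (hι : Topology.IsEmbedding ι)
    (k : ℕ) (hk : k < n) (p q : X) (hpq : (p, q) ∈ LipFlow.pairs n X k) :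
    ∃ B B' : Set X,
      LipFlow.IsClosedNhdIn (LipFlow.stratum n X k) B p ∧
      LipFlow.IsClosedNhdIn (LipFlow.stratum n X k) B' q ∧
      B ∩ LipFlow.stratum n X (k + 1) = ∅ ∧
      B' ∩ LipFlow.stratum n X (k + 1) = ∅ ∧
      B ∩ B' = ∅ ∧
      IsOpen (LipFlow.separating ι k B B') ∧
      Dense (LipFlow.separating ι k B B') := by
  obtain ⟨hp, hq, hne, -⟩ := hpq
  change p ≠ q at hne
  -- Here `k < n` is read as `k + 1 ≤ n`: `p` is not fixed, so some `v` moves it.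
  have hpn : p ∉ LipFlow.stratum n X n := fun h => hp.2 (LipFlow.stratum_antitone hk h)
  obtain ⟨v, L, z, hL, hz, hzL, hzI, hzfix, hzp, hzq⟩ := LipFlow.exists_bump hpn hne
  have hS : IsOpen (LipFlow.stratum n X (k + 1))ᶜ :=
    (LipFlow.isClosed_stratum (k + 1)).isOpen_compl
  obtain ⟨U, hU, U', hU', hUU⟩ := Filter.disjoint_iff.1 (disjoint_nhds_nhds.2 hne)
  obtain ⟨D, ⟨hD, hDc⟩, hDs⟩ := (closed_nhds_basis p).mem_iff.1
    (Filter.inter_mem (Filter.inter_mem hzp (hS.mem_nhds hp.2)) hU)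
  obtain ⟨D', ⟨hD', hDc'⟩, hDs'⟩ := (closed_nhds_basis q).mem_iff.1
    (Filter.inter_mem (Filter.inter_mem hzq (hS.mem_nhds hq.2)) hU')
  have hk := LipFlow.isClosed_stratum (n := n) (X := X) k
  have e1 : LipFlow.stratum n X k ∩ D ∩ LipFlow.stratum n X (k + 1) = ∅ :=
    Set.eq_empty_of_forall_notMem fun x hx => (hDs hx.1.2).1.2 hx.2
  have e2 : LipFlow.stratum n X k ∩ D' ∩ LipFlow.stratum n X (k + 1) = ∅ :=
    Set.eq_empty_of_forall_notMem fun x hx => (hDs' hx.1.2).1.2 hx.2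
  have e3 : (LipFlow.stratum n X k ∩ D) ∩ (LipFlow.stratum n X k ∩ D') = ∅ :=
    Set.eq_empty_of_forall_notMem fun x hx =>
      Set.disjoint_left.1 hUU (hDs hx.1.2).2 (hDs' hx.2.2).2
  refine ⟨LipFlow.stratum n X k ∩ D, LipFlow.stratum n X k ∩ D',
    ⟨Set.inter_subset_left, (hk.inter hDc).preimage continuous_subtype_val,
      Filter.inter_mem self_mem_nhdsWithin (mem_nhdsWithin_of_mem_nhds hD)⟩,
    ⟨Set.inter_subset_left, (hk.inter hDc').preimage continuous_subtype_val,
      Filter.inter_mem self_mem_nhdsWithin (mem_nhdsWithin_of_mem_nhds hD')⟩, e1, e2, e3, ?_, ?_⟩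
  · exact LipFlow.isOpen_separating ι (LipFlow.isCompact_prod_inter_pairs (hk.inter hDc)
      (hk.inter hDc') Set.inter_subset_left Set.inter_subset_left e1 e2 e3)
  · exact LipFlow.dense_separating ι hL hz hzL hzI hzfix (fun x hx => (hDs hx.2).1.1)
      fun y hy => (hDs' hy.2).1.1
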